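/- Let $M_{m,1}$ denote the space of all (affine) lines in $\mathbb R^m$ with its usual metric topology. For a compact metric space $X$, a continuous map $g\colon X\to\mathbb R^m$ and a point $z\notin g(X)$, put $$P_{2,1,m}(g,z)=\{\Pi\in M_{m,1} : z\in \Pi \text{ and } |g^{-1}(\Pi)|\ge 2\},$$ considered as a subspace of $M_{m,1}$. **Theorem 1.1.** Let $n\ge 0$ be an integer, let $X$ be a metric compactum of covering dimension $\dim X\le n$, and let $m\ge 2n+1$. Then the set of all continuous maps $g\colon X\to\mathbb R^m$ such that $\dim P_{2,1,m}(g,z)\le 0$ for all $z\in\mathbb R^m\setminus g(X)$ is a dense $G_\delta$-subset of the space $C(X,\mathbb R^m)$ of all continuous maps from $X$ to $\mathbb R^m$ with the topology of uniform convergence. -/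

import Mathlib

/-- `CoveringDimLE X n` means `dim X ≤ n` for the (Lebesgue) covering dimension: every finite open
cover of `X` has a finite open refinement that covers `X` and has order `≤ n`, i.e. such that every
point of `X` belongs to at most `n + 1` of its elements. The empty space, which has dimension `-1`,
satisfies this for all `n`. -/
def CoveringDimLE (X : Type*) [TopologicalSpace X] (n : ℕ) : Prop :=
  ∀ 𝒰 : Set (Set X), 𝒰.Finite → (∀ U ∈ 𝒰, IsOpen U) → ⋃₀ 𝒰 = Set.univ →
    ∃ 𝒱 : Set (Set X), 𝒱.Finite ∧ (∀ V ∈ 𝒱, IsOpen V) ∧ ⋃₀ 𝒱 = Set.univ ∧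
      (∀ V ∈ 𝒱, ∃ U ∈ 𝒰, V ⊆ U) ∧
      ∀ x : X, {V ∈ 𝒱 | x ∈ V}.encard ≤ (n + 1 : ℕ)

/-- The set `M_{m,d}` of all `d`-dimensional planes (affine subspaces) of `ℝ^m`. -/
structure AffinePlane (m d : ℕ) where
  /-- the underlying affine subspace -/
  toAffineSubspace : AffineSubspace ℝ (EuclideanSpace ℝ (Fin m))
  nonempty : (toAffineSubspace : Set (EuclideanSpace ℝ (Fin m))).Nonempty
  finrank_direction : Module.finrank ℝ toAffineSubspace.direction = d

namespace AffinePlane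

/-- The foot of the perpendicular from the origin to a plane, i.e. the point of the plane nearest
to the origin. -/
noncomputable def foot {m d : ℕ} (P : AffinePlane m d) : EuclideanSpace ℝ (Fin m) :=
  haveI : Nonempty P.toAffineSubspace := P.nonempty.to_subtype
  (EuclideanGeometry.orthogonalProjection P.toAffineSubspace
    (0 : EuclideanSpace ℝ (Fin m)) : EuclideanSpace ℝ (Fin m))

/-- The orthogonal projection of `ℝ^m` onto the linear subspace parallel to a plane. -/
noncomputable def directionProjection {m d : ℕ} (P : AffinePlane m d) :
    EuclideanSpace ℝ (Fin m) →L[ℝ] EuclideanSpace ℝ (Fin m) :=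
  P.toAffineSubspace.direction.starProjection

/-- The usual topology of the affine Grassmannian `M_{m,d}`: a plane is determined by the orthogonal
projection onto its direction and its foot, and the topology is the one of the metric
`‖p(P) - p(Q)‖ + ‖foot P - foot Q‖`, where `p` denotes the direction projection. -/
noncomputable instance (m d : ℕ) : TopologicalSpace (AffinePlane m d) :=
  TopologicalSpace.induced (fun P => (P.directionProjection, P.foot)) inferInstance

end AffinePlane

/-- `P_{q,d,m}(g, z)`: the set of all `d`-planes in `ℝ^m` that contain `z` and whose preimage
under `g` has at least `q` points. As a subset of `AffinePlane m d` it carries the subspace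
topology. -/
def planesThrough {X : Type*} [TopologicalSpace X] (q d m : ℕ)
    (g : C(X, EuclideanSpace ℝ (Fin m))) (z : EuclideanSpace ℝ (Fin m)) :
    Set (AffinePlane m d) :=
  {P | (q : ℕ∞) ≤ (g ⁻¹' (P.toAffineSubspace : Set (EuclideanSpace ℝ (Fin m)))).encard ∧
    z ∈ P.toAffineSubspace}

/-!
A set of lines through `z` has dimension `≤ 0` as soon as it is a countable union of compact sets of
dimension `≤ 0` (`coveringDimLE_zero_of_iUnion_isClosed`), and a compact set has dimension `≤ 0`
exactly when, at every scale `ε`, it is covered by disjoint open sets of diameter at most `ε`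
(`FinelySeparated`). For `z` off the image of `g`, the secants through `z` that join `g x` and `g y`
with `dist x y ≥ δ` form a compact set (`secantData δ g z`), and these sets exhaust
`planesThrough 2 1 m g z` as `δ → 0`.

So the maps in question are the intersection of countably many sets `separatedMaps`, in which `δ`,
the scale `ε`, a bound for `‖z‖` and a lower bound for the distance of `z` from the image of `g` are
fixed. Each of them is open: the offending pairs `(g, z)` form a closed set, which is projected along
the compact ball that contains `z`. Each of them is dense (`dense_separatedMaps`): take a partition
of unity `ψ` subordinate to a cover of order `n` by sets of diameter less than `δ` and approximate a
given map by `g x = ∑ ψ V x • p V` with points `p V` in general position. If `dist x y ≥ δ`, the sets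
of the cover that contain `x` and those that contain `y` are different, and there are at most
`2 n + 2 ≤ m + 1` of them in all. Hence the corresponding points `p V` are affinely independent, so
that the affine spans of the two groups are skew, and through `z` there is at most one line that
meets both. Thus `secantData δ g z` is finite (`finite_secantData`) and trivially finely separated.
The Baire category theorem in `C(X, ℝ^m)` finishes the proof.
-/

/-! ### Covering dimension zero -/

/-- A finite open cover of a space of dimension `≤ 0` shrinks to a partition into open sets. -/
theorem CoveringDimLE.exists_disjoint_shrinking {Y : Type*} [TopologicalSpace Y]
    (h : CoveringDimLE Y 0) {ι : Type*} [Finite ι] (U : ι → Set Y) (hU : ∀ i, IsOpen (U i))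
    (hcov : ⋃ i, U i = Set.univ) :
    ∃ G : ι → Set Y, (∀ i, IsOpen (G i)) ∧ ⋃ i, G i = Set.univ ∧ (∀ i, G i ⊆ U i) ∧
      Pairwise (Function.onFun Disjoint G) := by
  obtain ⟨𝒱, -, hVo, hVc, hVr, hV1⟩ := h (Set.range U) (Set.finite_range U)
    (by rintro _ ⟨i, rfl⟩; exact hU i) (by rwa [Set.sUnion_range])
  have hr : ∀ V : 𝒱, ∃ i, (V : Set Y) ⊆ U i := fun V => by
    obtain ⟨_, ⟨i, rfl⟩, hi⟩ := hVr V V.2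
    exact ⟨i, hi⟩
  choose idx hidx using hr
  refine ⟨fun i => ⋃ V ∈ {V : 𝒱 | idx V = i}, (V : Set Y),
    fun i => isOpen_biUnion fun V _ => hVo V V.2, ?_, ?_, ?_⟩
  · refine Set.eq_univ_of_forall fun x => ?_
    obtain ⟨V, hV, hx⟩ : x ∈ ⋃₀ 𝒱 := hVc ▸ Set.mem_univ x
    exact Set.mem_iUnion.2 ⟨idx ⟨V, hV⟩, Set.mem_biUnion (x := ⟨V, hV⟩) rfl hx⟩
  · intro i
    refine Set.iUnion₂_subset fun V hV => ?_
    obtain rfl : idx V = i := hV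
    exact hidx V
  · intro i j hij
    rw [Function.onFun, Set.disjoint_left]
    intro x hxi hxj
    obtain ⟨V, hVi, hxV⟩ := Set.mem_iUnion₂.1 hxi
    obtain ⟨W, hWj, hxW⟩ := Set.mem_iUnion₂.1 hxj
    have hle : {V ∈ 𝒱 | x ∈ V}.encard ≤ 1 := by simpa using hV1 x
    have hVW : (V : Set Y) = W := Set.encard_le_one_iff.1 hle _ _ ⟨V.2, hxV⟩ ⟨W.2, hxW⟩
    obtain rfl := Subtype.ext hVW
    exact hij (hVi.symm.trans hWj)

theorem coveringDimLE_zero_of_disjoint_shrinking {Y : Type*} [TopologicalSpace Y]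
    (h : ∀ 𝒰 : Set (Set Y), 𝒰.Finite → (∀ U ∈ 𝒰, IsOpen U) → ⋃₀ 𝒰 = Set.univ →
      ∃ G : 𝒰 → Set Y, (∀ i, IsOpen (G i)) ∧ ⋃ i, G i = Set.univ ∧ (∀ i : 𝒰, G i ⊆ i) ∧
        Pairwise (Function.onFun Disjoint G)) :
    CoveringDimLE Y 0 := by
  intro 𝒰 hfin hU hcov
  obtain ⟨G, hGo, hGc, hGU, hGd⟩ := h 𝒰 hfin hU hcov
  have := hfin.to_subtype
  refine ⟨Set.range G, Set.finite_range G, ?_, by rwa [Set.sUnion_range], ?_, fun x => ?_⟩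
  · rintro _ ⟨i, rfl⟩
    exact hGo i
  · rintro _ ⟨i, rfl⟩
    exact ⟨i, i.2, hGU i⟩
  · refine le_trans (Set.encard_le_one_iff.2 ?_) (by simp)
    rintro _ _ ⟨⟨i, rfl⟩, hi⟩ ⟨⟨j, rfl⟩, hj⟩
    by_contra hne
    exact Set.disjoint_left.1 (hGd fun hij => hne (congrArg G hij)) hi hj

/-- In a pseudometric space, disjoint closed sets, finitely many, swell to disjoint open sets:
take the points that are closer to the given closed set than to any of the others. -/
theorem exists_disjoint_open_swelling {Y : Type*} [TopologicalSpace Y]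
    [TopologicalSpace.PseudoMetrizableSpace Y] {ι : Type*} [Finite ι] {F U : ι → Set Y}
    (hF : ∀ i, IsClosed (F i)) (hd : Pairwise (Function.onFun Disjoint F))
    (hU : ∀ i, IsOpen (U i)) (hFU : ∀ i, F i ⊆ U i) :
    ∃ G : ι → Set Y, (∀ i, IsOpen (G i)) ∧ (∀ i, F i ⊆ G i) ∧ (∀ i, G i ⊆ U i) ∧
      Pairwise (Function.onFun Disjoint G) := by
  let := TopologicalSpace.pseudoMetrizableSpacePseudoMetric Y
  refine ⟨fun i => {p | ∀ j, j ≠ i → Metric.infEDist p (F i) < Metric.infEDist p (F j)} ∩ U i,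
    fun i => ?_, fun i p hp => ⟨fun j hj => ?_, hFU i hp⟩, fun i => Set.inter_subset_right, ?_⟩
  · refine IsOpen.inter ?_ (hU i)
    simp only [Set.ofPred_forall]
    exact isOpen_iInter_of_finite fun j => isOpen_iInter_of_finite fun _ =>
      isOpen_lt Metric.continuous_infEDist Metric.continuous_infEDist
  · rw [Metric.infEDist_zero_of_mem hp, pos_iff_ne_zero]
    intro h0
    have := Metric.mem_closure_iff_infEDist_zero.2 h0
    rw [(hF j).closure_eq] at this
    exact Set.disjoint_left.1 (hd hj) this hp
  · intro i j hij
    refine Set.disjoint_left.2 fun p hi hj => ?_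
    exact lt_asymm (hi.1 j hij.symm) (hj.1 i hij)

/-- The inductive step of the countable sum theorem: disjoint closed sets `H i ⊆ U i` can be
enlarged so as to cover one more closed set of dimension `≤ 0`. -/
theorem exists_closed_enlargement {Y : Type*} [TopologicalSpace Y]
    [TopologicalSpace.PseudoMetrizableSpace Y] {ι : Type*} [Finite ι] {U H : ι → Set Y}
    (hU : ∀ i, IsOpen (U i)) (hcov : ⋃ i, U i = Set.univ) (hH : ∀ i, IsClosed (H i))
    (hd : Pairwise (Function.onFun Disjoint H)) (hHU : ∀ i, H i ⊆ U i)
    {C : Set Y} (hC : IsClosed C) (h0 : CoveringDimLE C 0) :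
    ∃ H' : ι → Set Y, (∀ i, IsClosed (H' i)) ∧ Pairwise (Function.onFun Disjoint H') ∧
      (∀ i, H' i ⊆ U i) ∧ (∀ i, H i ⊆ interior (H' i)) ∧ C ⊆ ⋃ i, interior (H' i) := by
  -- `O i` is the part of `U i` that avoids the closed sets already assigned to other indices.
  let O : ι → Set Y := fun i => U i ∩ ⋂ j, ⋂ _ : j ≠ i, (H j)ᶜ
  have hO : ∀ i, IsOpen (O i) := fun i => (hU i).inter <| isOpen_iInter_of_finite fun j =>
    isOpen_iInter_of_finite fun _ => (hH j).isOpen_compl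
  have hHO : ∀ i, H i ⊆ O i := fun i x hx => ⟨hHU i hx, Set.mem_iInter₂.2 fun j hj hxj =>
    Set.disjoint_left.1 (hd hj) hxj hx⟩
  have hOcov : ∀ x, ∃ i, x ∈ O i := by
    intro x
    by_cases hx : ∃ i, x ∈ H i
    · exact hx.imp fun i hi => hHO i hi
    · obtain ⟨i, hi⟩ := Set.mem_iUnion.1 (hcov ▸ Set.mem_univ x : x ∈ ⋃ i, U i)
      exact ⟨i, hi, Set.mem_iInter₂.2 fun j _ hxj => hx ⟨j, hxj⟩⟩
  obtain ⟨G, hGo, hGc, hGO, hGd⟩ := h0.exists_disjoint_shrinking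
    (fun i => ((↑) : C → Y) ⁻¹' O i) (fun i => (hO i).preimage continuous_subtype_val)
    (Set.eq_univ_of_forall fun x => Set.mem_iUnion.2 (hOcov x))
  have hGclosed : ∀ i, IsClosed (G i) := by
    intro i
    have : G i = (⋃ j, ⋃ _ : j ≠ i, G j)ᶜ := by
      ext x
      simp only [Set.mem_compl_iff, Set.mem_iUnion, not_exists]
      refine ⟨fun hx j hj hxj => Set.disjoint_left.1 (hGd hj) hxj hx, fun hx => ?_⟩
      obtain ⟨j, hj⟩ := Set.mem_iUnion.1 (hGc ▸ Set.mem_univ x : x ∈ ⋃ i, G i)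
      by_contra hxi
      exact hx j (fun hji => hxi (hji ▸ hj)) hj
    rw [this]
    exact (isOpen_iUnion fun j => isOpen_iUnion fun _ => hGo j).isClosed_compl
  let F : ι → Set Y := fun i => H i ∪ (↑) '' G i
  have hFclosed : ∀ i, IsClosed (F i) := fun i =>
    (hH i).union (hC.isClosedEmbedding_subtypeVal.isClosedMap _ (hGclosed i))
  have hFU : ∀ i, F i ⊆ U i := by
    rintro i x (hx | ⟨y, hy, rfl⟩)
    · exact hHU i hx
    · exact (hGO i hy).1
  have hFd : Pairwise (Function.onFun Disjoint F) := by
    intro i j hij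
    refine Set.disjoint_left.2 ?_
    rintro x (hx | ⟨y, hy, rfl⟩) (hx' | ⟨y', hy', hyy⟩)
    · exact Set.disjoint_left.1 (hd hij) hx hx'
    · subst hyy
      exact Set.mem_iInter₂.1 (hGO j hy').2 i hij hx
    · exact Set.mem_iInter₂.1 (hGO i hy).2 j hij.symm hx'
    · obtain rfl := Subtype.ext hyy
      exact Set.disjoint_left.1 (hGd hij) hy hy'
  obtain ⟨S, hSo, hFS, hSU, hSd⟩ := exists_disjoint_open_swelling hFclosed hFd hU hFU
  let := TopologicalSpace.pseudoMetrizableSpacePseudoMetric Y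
  choose T hTo hFT hTS using fun i => normal_exists_closure_subset (hFclosed i) (hSo i) (hFS i)
  have hTint : ∀ i, F i ⊆ interior (closure (T i)) := fun i =>
    (hFT i).trans (interior_maximal subset_closure (hTo i))
  refine ⟨fun i => closure (T i), fun i => isClosed_closure,
    fun i j hij => (hSd hij).mono (hTS i) (hTS j), fun i => (hTS i).trans (hSU i),
    fun i => Set.subset_union_left.trans (hTint i), fun x hx => ?_⟩
  obtain ⟨i, hi⟩ := Set.mem_iUnion.1 (hGc ▸ Set.mem_univ (⟨x, hx⟩ : C) : (⟨x, hx⟩ : C) ∈ ⋃ i, G i)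
  exact Set.mem_iUnion.2 ⟨i, hTint i (Or.inr ⟨_, hi, rfl⟩)⟩

/-- The countable sum theorem in dimension zero. -/
theorem coveringDimLE_zero_of_iUnion_isClosed {Y : Type*} [TopologicalSpace Y]
    [TopologicalSpace.PseudoMetrizableSpace Y] {C : ℕ → Set Y} (hC : ∀ k, IsClosed (C k))
    (hcov : ⋃ k, C k = Set.univ) (h0 : ∀ k, CoveringDimLE (C k) 0) : CoveringDimLE Y 0 := by
  refine coveringDimLE_zero_of_disjoint_shrinking fun 𝒰 hfin hU hUcov => ?_
  have := hfin.to_subtype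
  rw [Set.sUnion_eq_iUnion] at hUcov
  let S := {H : 𝒰 → Set Y // (∀ i, IsClosed (H i)) ∧ Pairwise (Function.onFun Disjoint H) ∧
    ∀ i : 𝒰, H i ⊆ i}
  have step : ∀ (k : ℕ) (H : S), ∃ H' : S, (∀ i, H.1 i ⊆ interior (H'.1 i)) ∧
      C k ⊆ ⋃ i, interior (H'.1 i) := by
    intro k H
    obtain ⟨H', h1, h2, h3, h4, h5⟩ := exists_closed_enlargement (fun i : 𝒰 => hU i i.2) hUcov
      H.2.1 H.2.2.1 H.2.2.2 (hC k) (h0 k)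
    exact ⟨⟨H', h1, h2, h3⟩, h4, h5⟩
  choose next hnext hnextC using step
  let H : ℕ → S := fun k => Nat.rec
    ⟨fun _ => ∅, fun _ => isClosed_empty, fun _ _ _ => Set.disjoint_empty _,
      fun _ => Set.empty_subset _⟩ next k
  have hHmono : ∀ i, Monotone fun k => (H k).1 i := fun i =>
    monotone_nat_of_le_succ fun k => (hnext k (H k) i).trans interior_subset
  refine ⟨fun i => ⋃ k, interior ((H k).1 i), fun i => isOpen_iUnion fun _ => isOpen_interior,
    Set.eq_univ_of_forall fun x => ?_,
    fun i => Set.iUnion_subset fun k => interior_subset.trans ((H k).2.2.2 i), fun i j hij => ?_⟩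
  · obtain ⟨k, hk⟩ := Set.mem_iUnion.1 (hcov ▸ Set.mem_univ x : x ∈ ⋃ k, C k)
    obtain ⟨i, hi⟩ := Set.mem_iUnion.1 (hnextC k (H k) hk)
    exact Set.mem_iUnion.2 ⟨i, Set.mem_iUnion.2 ⟨k + 1, hi⟩⟩
  · refine Set.disjoint_left.2 fun x hi hj => ?_
    obtain ⟨k, hk⟩ := Set.mem_iUnion.1 hi
    obtain ⟨l, hl⟩ := Set.mem_iUnion.1 hj
    exact Set.disjoint_left.1 ((H (max k l)).2.2.1 hij)
      (hHmono i (le_max_left k l) (interior_subset hk))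
      (hHmono j (le_max_right k l) (interior_subset hl))

/-! ### Fine separation by disjoint open sets -/

/-- `FinelySeparated ε K` means that `K` is covered by pairwise disjoint open sets of the ambient
space of diameter at most `ε`. -/
def FinelySeparated {F : Type*} [PseudoEMetricSpace F] (ε : ENNReal) (K : Set F) : Prop :=
  ∃ 𝒱 : Set (Set F), (∀ V ∈ 𝒱, IsOpen V) ∧ (∀ V ∈ 𝒱, Metric.ediam V ≤ ε) ∧
    𝒱.PairwiseDisjoint id ∧ K ⊆ ⋃₀ 𝒱

theorem FinelySeparated.of_isClosed_cover {F : Type*} [PseudoMetricSpace F] {ε : ENNReal}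
    {K : Set F} {ι : Type*} [Finite ι] {C B : ι → Set F} (hC : ∀ i, IsClosed (C i))
    (hd : Pairwise (Function.onFun Disjoint C)) (hB : ∀ i, IsOpen (B i)) (hCB : ∀ i, C i ⊆ B i)
    (hBε : ∀ i, Metric.ediam (B i) ≤ ε) (hK : K ⊆ ⋃ i, C i) : FinelySeparated ε K := by
  obtain ⟨G, hGo, hCG, hGB, hGd⟩ := exists_disjoint_open_swelling hC hd hB hCB
  refine ⟨Set.range G, ?_, ?_, ?_, ?_⟩
  · rintro _ ⟨i, rfl⟩
    exact hGo i
  · rintro _ ⟨i, rfl⟩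
    exact (Metric.ediam_mono (hGB i)).trans (hBε i)
  · rintro _ ⟨i, rfl⟩ _ ⟨j, rfl⟩ hij
    exact hGd fun h => hij (congrArg G h)
  · rw [Set.sUnion_range]
    exact hK.trans (Set.iUnion_mono hCG)

theorem Set.Finite.finelySeparated {F : Type*} [MetricSpace F] {K : Set F} (hK : K.Finite)
    {r : ℝ} (hr : 0 < r) : FinelySeparated (2 * ENNReal.ofReal r) K := by
  have := hK.to_subtype
  refine FinelySeparated.of_isClosed_cover (C := fun p : K => {(p : F)})
    (B := fun p : K => Metric.ball p r) (fun _ => isClosed_singleton) ?_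
    (fun _ => Metric.isOpen_ball) (fun p => by simpa using hr) (fun p => ?_)
    (fun p hp => Set.mem_iUnion.2 ⟨⟨p, hp⟩, rfl⟩)
  · intro p q hpq
    simpa [Function.onFun, Subtype.ext_iff] using fun h => hpq (Subtype.ext h)
  · rw [← Metric.eball_ofReal]
    exact Metric.ediam_eball_le

/-- If `Y` has dimension `≤ 0` and `f` induces its topology, then a compact subset of the image of
`f` is finely separated. -/
theorem CoveringDimLE.finelySeparated {Y F : Type*} [TopologicalSpace Y] [MetricSpace F]
    (h : CoveringDimLE Y 0) {f : Y → F} (hf : Topology.IsInducing f) {K : Set F}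
    (hK : IsCompact K) (hKf : K ⊆ Set.range f) {r : ℝ} (hr : 0 < r) :
    FinelySeparated (2 * ENNReal.ofReal r) K := by
  obtain ⟨t, -, htfin, htK⟩ := hK.finite_cover_balls hr
  have := htfin.to_subtype
  -- The index `none` stands for the complement of `K`, so that `B` covers the whole image of `f`.
  let B : Option t → Set F := fun i => i.elim Kᶜ fun c => Metric.ball (c : F) r
  have hB : ∀ i, IsOpen (B i) := by
    rintro (_ | c)
    exacts [hK.isClosed.isOpen_compl, Metric.isOpen_ball]
  obtain ⟨G, hGo, hGc, hGB, hGd⟩ := h.exists_disjoint_shrinking (fun i => f ⁻¹' B i)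
    (fun i => (hB i).preimage hf.continuous) (by
      refine Set.eq_univ_of_forall fun y => Set.mem_iUnion.2 ?_
      by_cases hy : f y ∈ K
      · obtain ⟨c, hc, hyc⟩ := Set.mem_iUnion₂.1 (htK hy)
        exact ⟨some ⟨c, hc⟩, hyc⟩
      · exact ⟨none, hy⟩)
  choose G' hG'o hG' using fun i => hf.isOpen_iff.1 (hGo i)
  have key : ∀ p ∈ K, ∃ i : t, p ∈ G' (some i) ∧ p ∈ Metric.ball (i : F) r ∧
      ∀ j : t, j ≠ i → p ∉ G' (some j) := by
    intro p hp
    obtain ⟨y, rfl⟩ := hKf hp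
    obtain ⟨i, hi⟩ := Set.mem_iUnion.1 (hGc ▸ Set.mem_univ y : y ∈ ⋃ i, G i)
    rcases i with _ | i
    · exact absurd hp (hGB none hi)
    · refine ⟨i, by rw [← hG'] at hi; exact hi, hGB _ hi, fun j hj hyj => ?_⟩
      have hyj' : y ∈ G (some j) := by rw [← hG']; exact hyj
      exact Set.disjoint_left.1 (hGd fun h => hj (Option.some_injective _ h)) hyj' hi
  refine FinelySeparated.of_isClosed_cover
    (C := fun i : t => K \ ⋃ j : t, ⋃ _ : j ≠ i, G' (some j))
    (B := fun i : t => Metric.ball (i : F) r) (fun i => ?_) ?_ (fun _ => Metric.isOpen_ball) ?_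
    (fun i => ?_) ?_
  · exact hK.isClosed.sdiff (isOpen_iUnion fun j => isOpen_iUnion fun _ => hG'o _)
  · intro i j hij
    refine Set.disjoint_left.2 fun p hi hj => ?_
    obtain ⟨k, hk, -, -⟩ := key p hi.1
    by_cases hki : k = i
    · exact hj.2 (Set.mem_iUnion₂.2 ⟨k, hki ▸ hij, hk⟩)
    · exact hi.2 (Set.mem_iUnion₂.2 ⟨k, hki, hk⟩)
  · intro i p hp
    obtain ⟨k, hk, hkb, -⟩ := key p hp.1
    by_cases hki : k = i
    · exact hki ▸ hkb
    · exact absurd (Set.mem_iUnion₂.2 ⟨k, hki, hk⟩) hp.2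
  · rw [← Metric.eball_ofReal]
    exact Metric.ediam_eball_le
  · intro p hp
    obtain ⟨k, -, -, hk⟩ := key p hp
    exact Set.mem_iUnion.2 ⟨k, hp, fun h => by
      obtain ⟨j, hj, hpj⟩ := Set.mem_iUnion₂.1 h
      exact hk j hj hpj⟩

/-- A space whose topology is induced from a compact set that is finely separated at every scale
has dimension `≤ 0`. -/
theorem coveringDimLE_zero_of_finelySeparated {Y F : Type*} [TopologicalSpace Y] [MetricSpace F]
    {f : Y → F} (hf : Topology.IsInducing f) (hK : IsCompact (Set.range f))
    (hsep : ∀ k : ℕ, FinelySeparated (2 * ENNReal.ofReal (1 / (k + 1))) (Set.range f)) :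
    CoveringDimLE Y 0 := by
  refine coveringDimLE_zero_of_disjoint_shrinking fun 𝒰 hfin hU hUcov => ?_
  choose U' hU'o hU' using fun i : 𝒰 => hf.isOpen_iff.1 (hU i i.2)
  have hcov : Set.range f ⊆ ⋃ i, U' i := by
    rintro _ ⟨y, rfl⟩
    obtain ⟨V, hV, hy⟩ : y ∈ ⋃₀ 𝒰 := hUcov ▸ Set.mem_univ y
    refine Set.mem_iUnion.2 ⟨⟨V, hV⟩, ?_⟩
    rw [← Set.mem_preimage, hU']
    exact hy
  obtain ⟨δ, hδ, hLeb⟩ := lebesgue_number_lemma_of_metric hK hU'o hcov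
  obtain ⟨k, hk⟩ := exists_nat_one_div_lt (half_pos hδ)
  obtain ⟨𝒱, hVo, hVε, hVd, hVK⟩ := hsep k
  have hsmall : ∀ V : {V : Set F // V ∈ 𝒱 ∧ (V ∩ Set.range f).Nonempty},
      ∃ i : 𝒰, V.1 ⊆ U' i := by
    rintro ⟨V, hV, p, hpV, hpf⟩
    obtain ⟨i, hi⟩ := hLeb p hpf
    refine ⟨i, fun q hq => hi ?_⟩
    have h1 : edist q p ≤ 2 * ENNReal.ofReal (1 / (k + 1)) :=
      (Metric.edist_le_ediam_of_mem hq hpV).trans (hVε V hV)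
    have h2 : (2 : ENNReal) * ENNReal.ofReal (1 / (k + 1)) = ENNReal.ofReal (2 * (1 / (k + 1))) := by
      rw [ENNReal.ofReal_mul (by norm_num)]
      simp
    rw [h2, edist_dist, ENNReal.ofReal_le_ofReal_iff (by positivity)] at h1
    rw [Metric.mem_ball]
    linarith
  choose idx hidx using hsmall
  refine ⟨fun i => f ⁻¹' ⋃ V, ⋃ _ : idx V = i, V.1,
    fun i => ?_, ?_, fun i y hy => ?_, fun i j hij => ?_⟩
  · exact hf.continuous.isOpen_preimage _ <|
      isOpen_iUnion fun V => isOpen_iUnion fun _ => hVo V V.2.1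
  · refine Set.eq_univ_of_forall fun y => ?_
    obtain ⟨V, hV, hy⟩ := hVK ⟨y, rfl⟩
    let W : {V : Set F // V ∈ 𝒱 ∧ (V ∩ Set.range f).Nonempty} := ⟨V, hV, f y, hy, y, rfl⟩
    exact Set.mem_iUnion.2 ⟨idx W, Set.mem_iUnion₂.2 ⟨W, rfl, hy⟩⟩
  · obtain ⟨V, rfl, hyV⟩ := Set.mem_iUnion₂.1 hy
    rw [← hU']
    exact hidx V hyV
  · refine Set.disjoint_left.2 fun y hi hj => ?_
    obtain ⟨V, rfl, hyV⟩ := Set.mem_iUnion₂.1 hi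
    obtain ⟨W, rfl, hyW⟩ := Set.mem_iUnion₂.1 hj
    exact Set.disjoint_left.1 (hVd V.2.1 W.2.1 fun h => hij (congrArg idx (Subtype.ext h))) hyV hyW

/-! ### Points in general position -/

/-- The affine span of at most `d` points of a `d`-dimensional space is proper. -/
theorem affineSpan_image_finset_ne_top {E ι : Type*} [AddCommGroup E] [Module ℝ E]
    (p : ι → E) {s : Finset ι} (hs : s.card ≤ Module.finrank ℝ E) :
    affineSpan ℝ (p '' s) ≠ ⊤ := by
  classical
  rcases s.eq_empty_or_nonempty with rfl | hne
  · simp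
  intro h
  obtain ⟨k, hk⟩ := Nat.exists_eq_succ_of_ne_zero hne.card_pos.ne'
  have h1 := finrank_vectorSpan_image_finset_le ℝ p s hk
  rw [Finset.coe_image, ← direction_affineSpan, h, AffineSubspace.direction_top,
    finrank_top] at h1
  omega

/-- Finitely many points of a `d`-dimensional space can be moved slightly into general position:
any `d + 1` of them (and any fewer) become affinely independent. Affine independence is expressed
through weights with small support. -/
theorem exists_near_generalPosition {E ι : Type*} [NormedAddCommGroup E] [NormedSpace ℝ E]
    [FiniteDimensional ℝ E] [Fintype ι] (c : ι → E) {η : ℝ} (hη : 0 < η) :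
    ∃ p : ι → E, (∀ i, dist (p i) (c i) < η) ∧
      ∀ w : ι → ℝ, (Function.support w).ncard ≤ Module.finrank ℝ E + 1 →
        ∑ i, w i = 0 → ∑ i, w i • p i = 0 → w = 0 := by
  classical
  suffices h : ∀ T : Finset ι, ∃ p : ι → E, (∀ i, dist (p i) (c i) < η) ∧
      ∀ w : ι → ℝ, Function.support w ⊆ T → (Function.support w).ncard ≤ Module.finrank ℝ E + 1 →
        ∑ i, w i = 0 → ∑ i, w i • p i = 0 → w = 0 by
    obtain ⟨p, hp, hw⟩ := h Finset.univ
    exact ⟨p, hp, fun w => hw w (by simp)⟩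
  intro T
  induction T using Finset.induction_on with
  | empty => exact ⟨c, fun i => by simpa using hη, fun w hw _ _ _ => by simpa using hw⟩
  | insert a T ha ih =>
    obtain ⟨p, hpc, hp⟩ := ih
    -- The new point has to avoid the affine spans of at most `d` of the old ones: a null set.
    let : MeasurableSpace E := borel E
    have : BorelSpace E := ⟨rfl⟩
    let μ : MeasureTheory.Measure E := MeasureTheory.Measure.addHaar
    have hnull : μ (⋃ s ∈ {s : Finset ι | s.card ≤ Module.finrank ℝ E},
        (affineSpan ℝ (p '' s) : Set E)) = 0 :=
      (MeasureTheory.measure_biUnion_null_iff (Set.to_countable _)).2 fun s hs =>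
        MeasureTheory.Measure.addHaar_affineSubspace μ _ (affineSpan_image_finset_ne_top p hs)
    obtain ⟨q, hqball, hq⟩ : ∃ q ∈ Metric.ball (c a) η, q ∉ ⋃ s ∈ {s : Finset ι |
        s.card ≤ Module.finrank ℝ E}, (affineSpan ℝ (p '' s) : Set E) := by
      by_contra! h
      exact (Metric.measure_ball_pos μ (c a) hη).ne' (MeasureTheory.measure_mono_null h hnull)
    refine ⟨Function.update p a q, fun i => ?_, fun w hwT hwc hw0 hwp => ?_⟩
    · rcases eq_or_ne i a with rfl | hi
      · simpa using hqball
      · simpa [hi] using hpc i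
    rw [← Finset.add_sum_erase _ _ (Finset.mem_univ a)] at hwp hw0
    have hcongr : ∑ i ∈ Finset.univ.erase a, w i • Function.update p a q i =
        ∑ i ∈ Finset.univ.erase a, w i • p i :=
      Finset.sum_congr rfl fun i hi => by
        rw [Function.update_of_ne (Finset.ne_of_mem_erase hi)]
    rw [hcongr, Function.update_self] at hwp
    by_cases hwa : w a = 0
    · refine hp w (fun i hi => ?_) hwc ?_ ?_
      · rcases Finset.mem_insert.1 (hwT hi) with rfl | h
        · exact absurd hwa hi
        · exact h
      · rw [← Finset.add_sum_erase _ _ (Finset.mem_univ a), hw0]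
      · rw [← Finset.add_sum_erase _ _ (Finset.mem_univ a)]
        rwa [hwa, zero_smul] at hwp ⊢
    · exfalso
      -- Otherwise `q` is an affine combination of the other points of the support.
      let s : Finset ι := (Finset.univ.filter fun i => w i ≠ 0).erase a
      have hsupp : (Function.support w).ncard = (Finset.univ.filter fun i => w i ≠ 0).card := by
        rw [← Set.ncard_coe_finset]
        congr 1
        ext i
        simp
      have hscard : s.card ≤ Module.finrank ℝ E := by
        rw [Finset.card_erase_of_mem (by simpa using hwa)]
        omega
      have hsub : s ⊆ Finset.univ.erase a := Finset.erase_subset_erase _ (Finset.filter_subset _ _)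
      have hzero : ∀ i ∈ Finset.univ.erase a, i ∉ s → w i = 0 := by
        intro i hi his
        by_contra hwi
        exact his (Finset.mem_erase.2 ⟨Finset.ne_of_mem_erase hi, by simpa using hwi⟩)
      rw [← Finset.sum_subset hsub hzero] at hw0
      rw [← Finset.sum_subset hsub fun i hi his => by rw [hzero i hi his, zero_smul]] at hwp
      have hsum : ∑ i ∈ s, (-(w a)⁻¹ * w i) = 1 := by
        rw [← Finset.mul_sum, eq_neg_of_add_eq_zero_right hw0, neg_mul_neg, inv_mul_cancel₀ hwa]
      have hqe : s.affineCombination ℝ p (fun i => -(w a)⁻¹ * w i) = q := by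
        rw [Finset.affineCombination_eq_linear_combination _ _ _ hsum]
        simp_rw [mul_smul]
        rw [← Finset.smul_sum, eq_neg_of_add_eq_zero_right hwp, smul_neg, neg_smul, neg_neg,
          smul_smul, inv_mul_cancel₀ hwa, one_smul]
      refine hq (Set.mem_biUnion (x := s) hscard ?_)
      rw [← hqe]
      exact affineCombination_mem_affineSpan_image hsum (fun i hi his => absurd hi his) p

/-! ### Lines through a point -/

/-- The coordinates, in the sense of the topology of `AffinePlane`, of the line through `z` and
`w ≠ z`: the orthogonal projection onto its direction, and the foot of the perpendicular from the
origin. -/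
noncomputable def lineData {E : Type*} [NormedAddCommGroup E] [InnerProductSpace ℝ E] (z w : E) :
    (E →L[ℝ] E) × E :=
  ((ℝ ∙ (w - z)).starProjection, z - (ℝ ∙ (w - z)).starProjection z)

theorem continuousOn_lineData {E : Type*} [NormedAddCommGroup E] [InnerProductSpace ℝ E] :
    ContinuousOn (fun q : E × E => lineData q.1 q.2) {q | q.2 ≠ q.1} := by
  have h : ∀ u : E, (ℝ ∙ u).starProjection =
      (‖u‖ ^ 2)⁻¹ • InnerProductSpace.rankOne ℝ u u := by
    intro u
    ext w
    rw [Submodule.starProjection_singleton]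
    simp [smul_smul, div_eq_inv_mul]
  have hne : ∀ q ∈ {q : E × E | q.2 ≠ q.1}, ‖q.2 - q.1‖ ^ 2 ≠ 0 := fun q hq => by
    simpa [sub_eq_zero] using hq
  have hproj : ContinuousOn (fun q : E × E => (ℝ ∙ (q.2 - q.1)).starProjection)
      {q | q.2 ≠ q.1} := by
    simp_rw [h]
    refine ContinuousOn.smul (ContinuousOn.inv₀ (by fun_prop) hne) ?_
    refine Continuous.continuousOn ?_
    have h1 : Continuous fun q : E × E => InnerProductSpace.rankOne ℝ (q.2 - q.1) :=
      (InnerProductSpace.rankOne ℝ (E := E) (F := E)).continuous.comp (by fun_prop)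
    exact h1.clm_apply (by fun_prop)
  exact hproj.prodMk (continuousOn_fst.sub (hproj.clm_apply continuousOn_fst))

namespace AffinePlane

/-- The map that defines the topology of `AffinePlane`. -/
noncomputable def coords {m d : ℕ} (P : AffinePlane m d) :
    (EuclideanSpace ℝ (Fin m) →L[ℝ] EuclideanSpace ℝ (Fin m)) × EuclideanSpace ℝ (Fin m) :=
  (P.directionProjection, P.foot)

theorem isInducing_coords (m d : ℕ) : Topology.IsInducing (coords (m := m) (d := d)) := ⟨rfl⟩

theorem direction_eq_span {m : ℕ} (P : AffinePlane m 1) {z w : EuclideanSpace ℝ (Fin m)}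
    (hz : z ∈ P.toAffineSubspace) (hw : w ∈ P.toAffineSubspace) (hzw : w ≠ z) :
    P.toAffineSubspace.direction = ℝ ∙ (w - z) := by
  refine (Submodule.eq_of_le_of_finrank_eq ?_ ?_).symm
  · rw [Submodule.span_singleton_le_iff_mem]
    exact AffineSubspace.vsub_mem_direction hw hz
  · rw [P.finrank_direction, finrank_span_singleton (sub_ne_zero.2 hzw)]

theorem coords_eq_lineData {m : ℕ} (P : AffinePlane m 1) {z w : EuclideanSpace ℝ (Fin m)}
    (hz : z ∈ P.toAffineSubspace) (hw : w ∈ P.toAffineSubspace) (hzw : w ≠ z) :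
    P.coords = lineData z w := by
  have hdir := P.direction_eq_span hz hw hzw
  refine Prod.ext ?_ ?_
  · simp only [coords, directionProjection, lineData]
    congr 1
  · have : Nonempty P.toAffineSubspace := P.nonempty.to_subtype
    have hfoot : P.foot = P.toAffineSubspace.direction.starProjection (0 - z) + z :=
      EuclideanGeometry.orthogonalProjection_apply_mem P.toAffineSubspace hz
    simp only [coords, lineData]
    rw [hfoot]
    simp_rw [hdir]
    rw [zero_sub, map_neg, neg_add_eq_sub]

/-- The line through two distinct points. -/
noncomputable def lineThrough {m : ℕ} {z w : EuclideanSpace ℝ (Fin m)} (hzw : w ≠ z) :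
    AffinePlane m 1 where
  toAffineSubspace := line[ℝ, z, w]
  nonempty := ⟨z, left_mem_affineSpan_pair ℝ z w⟩
  finrank_direction := by
    rw [direction_affineSpan, vectorSpan_pair_rev, vsub_eq_sub,
      finrank_span_singleton (sub_ne_zero.2 hzw)]

end AffinePlane

/-! ### Secants through a point -/

/-- Coordinates of the lines through `z` that meet the image of `g` in `g x` and `g y` for some
`x` and `y` at distance at least `δ`. The equation is a division-free form of
"`z`, `g x` and `g y` are collinear". -/
def secantData {X E : Type*} [MetricSpace X] [NormedAddCommGroup E] [InnerProductSpace ℝ E]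
    (δ : ℝ) (g : X → E) (z : E) : Set ((E →L[ℝ] E) × E) :=
  {q | ∃ x y, δ ≤ dist x y ∧
    ‖g x - z‖ ^ 2 • (g y - z) = inner ℝ (g x - z) (g y - z) • (g x - z) ∧ lineData z (g x) = q}

theorem isCompact_secantData {X E : Type*} [MetricSpace X] [CompactSpace X] [NormedAddCommGroup E]
    [InnerProductSpace ℝ E] (δ : ℝ) {g : X → E} (hg : Continuous g) {z : E}
    (hz : z ∉ Set.range g) : IsCompact (secantData δ g z) := by
  have hclosed : IsClosed {p : X × X | δ ≤ dist p.1 p.2 ∧ ‖g p.1 - z‖ ^ 2 • (g p.2 - z) =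
      inner ℝ (g p.1 - z) (g p.2 - z) • (g p.1 - z)} :=
    IsClosed.and (isClosed_le (by fun_prop) (by fun_prop))
      (isClosed_eq (by fun_prop) (by fun_prop))
  have hcont : Continuous fun p : X × X => lineData z (g p.1) :=
    continuousOn_lineData.comp_continuous (f := fun p : X × X => (z, g p.1)) (by fun_prop)
      fun p h => hz ⟨p.1, h⟩
  convert hclosed.isCompact.image hcont using 1
  ext q
  simp [secantData, and_assoc]

/-- In a map that is "piecewise linear" with vertices in general position, a point off the image
lies on only finitely many secants joining images of distant points: the carriers `A`, `B` of two
distant points are disjoint, so their vertices are jointly affinely independent, and at most one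
line through `z` meets the affine spans of both. -/
theorem finite_secantData {X E ι : Type*} [MetricSpace X] [NormedAddCommGroup E]
    [InnerProductSpace ℝ E] [Fintype ι] {n : ℕ} {δ : ℝ} {p : ι → E} {φ : X → ι → ℝ}
    (hp : ∀ w : ι → ℝ, (Function.support w).ncard ≤ 2 * n + 2 →
      ∑ i, w i = 0 → ∑ i, w i • p i = 0 → w = 0)
    (hφ : ∀ x, ∑ i, φ x i = 1) (hcard : ∀ x, (Function.support (φ x)).ncard ≤ n + 1)
    (hdisj : ∀ x y, δ ≤ dist x y → Disjoint (Function.support (φ x)) (Function.support (φ y)))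
    {z : E} (hz : ∀ x, ∑ i, φ x i • p i ≠ z) :
    (secantData δ (fun x => ∑ i, φ x i • p i) z).Finite := by
  set g : X → E := fun x => ∑ i, φ x i • p i with hg
  refine Set.Finite.subset (s := ⋃ AB : Set ι × Set ι, {q | ∃ x y, δ ≤ dist x y ∧
    ‖g x - z‖ ^ 2 • (g y - z) = inner ℝ (g x - z) (g y - z) • (g x - z) ∧ lineData z (g x) = q ∧
    Function.support (φ x) = AB.1 ∧ Function.support (φ y) = AB.2}) ?_ ?_
  swap
  · rintro q ⟨x, y, h1, h2, h3⟩
    exact Set.mem_iUnion.2 ⟨(Function.support (φ x), Function.support (φ y)),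
      x, y, h1, h2, h3, rfl, rfl⟩
  refine Set.finite_iUnion fun ⟨A, B⟩ => Set.Subsingleton.finite ?_
  rintro _ ⟨x₁, y₁, hd₁, hc₁, rfl, hA₁, hB₁⟩ _ ⟨x₂, y₂, hd₂, hc₂, rfl, hA₂, hB₂⟩
  simp only at hA₁ hB₁ hA₂ hB₂
  have hAB : Disjoint A B := hA₁ ▸ hB₁ ▸ hdisj _ _ hd₁
  have hcardAB : (A ∪ B).ncard ≤ 2 * n + 2 := by
    refine (Set.ncard_union_le A B).trans ?_
    have h1 := hcard x₁
    have h2 := hcard y₁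
    rw [hA₁] at h1
    rw [hB₁] at h2
    omega
  have hA0 : ∀ {x}, Function.support (φ x) = A → ∀ i ∉ A, φ x i = 0 := fun h i hi => by
    rwa [← h, Function.notMem_support] at hi
  have hind : ∀ w : ι → ℝ, (∀ i ∉ A, i ∉ B → w i = 0) → ∑ i, w i = 0 → ∑ i, w i • p i = 0 →
      w = 0 := fun w hw => hp w <| (Set.ncard_le_ncard (fun i hi => by
        by_contra h
        rw [Set.mem_union, not_or] at h
        exact hi (hw i h.1 h.2)) (Set.toFinite _)).trans hcardAB
  -- `g y - z` is a multiple of `g x - z`, by a factor other than `0` and `1`.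
  have hratio : ∀ x y, δ ≤ dist x y → ‖g x - z‖ ^ 2 • (g y - z) =
      inner ℝ (g x - z) (g y - z) • (g x - z) → Function.support (φ x) = A →
      Function.support (φ y) = B → ∃ c : ℝ, c ≠ 0 ∧ c ≠ 1 ∧ g y - z = c • (g x - z) := by
    intro x y hd hc hA hB
    have hu : ‖g x - z‖ ^ 2 ≠ 0 := by
      have := sub_ne_zero.2 (hz x)
      positivity
    have hcc : g y - z = (inner ℝ (g x - z) (g y - z) / ‖g x - z‖ ^ 2) • (g x - z) := by
      rw [div_eq_inv_mul, mul_smul, ← hc, smul_smul, inv_mul_cancel₀ hu, one_smul]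
    refine ⟨_, fun h0 => ?_, fun h1 => ?_, hcc⟩
    · rw [h0, zero_smul] at hcc
      exact hz y (sub_eq_zero.1 hcc)
    · rw [h1, one_smul, sub_left_inj] at hcc
      have hw := hind (φ y - φ x)
        (fun i hiA hiB => by simp [hA0 hA i hiA, Function.notMem_support.1 (hB ▸ hiB : i ∉ _)])
        (by simp [hφ]) (by simpa [sub_smul, sub_eq_zero] using hcc)
      have hx0 : ∀ i, φ x i = 0 := by
        intro i
        by_cases hi : i ∈ A
        · have h2 := congrFun hw i
          have hiB : i ∉ Function.support (φ y) := hB ▸ Set.disjoint_left.1 hAB hi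
          simpa [Function.notMem_support.1 hiB] using h2
        · exact hA0 hA i hi
      simpa [hx0] using hφ x
  obtain ⟨c₁, h0₁, h1₁, e₁⟩ := hratio _ _ hd₁ hc₁ hA₁ hB₁
  obtain ⟨c₂, h0₂, h1₂, e₂⟩ := hratio _ _ hd₂ hc₂ hA₂ hB₂
  -- Eliminating `z` from the two collinearity relations gives an affine relation.
  have hw := hind ((1 - c₂) • (φ y₁ - c₁ • φ x₁) - (1 - c₁) • (φ y₂ - c₂ • φ x₂))
    (fun i hiA hiB => by
      simp [hA0 hA₁ i hiA, hA0 hA₂ i hiA, Function.notMem_support.1 (hB₁ ▸ hiB : i ∉ _),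
        Function.notMem_support.1 (hB₂ ▸ hiB : i ∉ _)])
    (by
      simp only [Pi.sub_apply, Pi.smul_apply, smul_eq_mul, Finset.sum_sub_distrib,
        ← Finset.mul_sum, hφ]
      ring)
    (by
      have : ∑ i, ((1 - c₂) • (φ y₁ - c₁ • φ x₁) - (1 - c₁) • (φ y₂ - c₂ • φ x₂)) i • p i =
          (1 - c₂) • (g y₁ - c₁ • g x₁) - (1 - c₁) • (g y₂ - c₂ • g x₂) := by
        simp only [hg, Finset.smul_sum, ← Finset.sum_sub_distrib, Pi.sub_apply, Pi.smul_apply,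
          smul_eq_mul, sub_smul, mul_smul, smul_sub]
      rw [this, sub_eq_iff_eq_add.1 e₁, sub_eq_iff_eq_add.1 e₂]
      module)
  have hprop : ∀ i, (1 - c₂) * c₁ * φ x₁ i = (1 - c₁) * c₂ * φ x₂ i := by
    intro i
    by_cases hi : i ∈ A
    · have h := congrFun hw i
      have hiB := Set.disjoint_left.1 hAB hi
      simp only [Pi.sub_apply, Pi.smul_apply, smul_eq_mul, Pi.zero_apply,
        Function.notMem_support.1 (hB₁ ▸ hiB : i ∉ _),
        Function.notMem_support.1 (hB₂ ▸ hiB : i ∉ _)] at h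
      linarith
    · rw [hA0 hA₁ i hi, hA0 hA₂ i hi, mul_zero, mul_zero]
  have hk : (1 - c₂) * c₁ = (1 - c₁) * c₂ := by
    have := Finset.sum_congr (rfl : Finset.univ = Finset.univ) fun i _ => hprop i
    simpa only [← Finset.mul_sum, hφ, mul_one] using this
  have hφe : φ x₁ = φ x₂ := by
    funext i
    refine mul_left_cancel₀ (mul_ne_zero (sub_ne_zero.2 h1₂.symm) h0₁) ?_
    rw [hprop, hk]
  simp only [hg, hφe]

/-! ### The open dense sets of maps -/

/-- The maps `g` such that, for all `z` of norm at most `R` and at distance at least `η` from the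
image of `g`, the secants through `z` between points of `X` at distance at least `δ` form a set
that is finely separated at scale `ε`. -/
def separatedMaps (X E : Type*) [MetricSpace X] [NormedAddCommGroup E] [InnerProductSpace ℝ E]
    (R η δ : ℝ) (ε : ENNReal) : Set C(X, E) :=
  {g | ∀ z, ‖z‖ ≤ R → (∀ x, η ≤ ‖g x - z‖) → FinelySeparated ε (secantData δ g z)}

/-- Openness: every covering by disjoint small open sets persists under small perturbations of `g`
and `z`, and `z` ranges over a compact set. -/
theorem isOpen_separatedMaps {X E : Type*} [MetricSpace X] [CompactSpace X]
    [NormedAddCommGroup E] [InnerProductSpace ℝ E] [FiniteDimensional ℝ E] (R : ℝ) {η : ℝ}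
    (hη : 0 < η) (δ : ℝ) (ε : ENNReal) : IsOpen (separatedMaps X E R η δ ε) := by
  let Z := Metric.closedBall (0 : E) R
  have : CompactSpace Z := isCompact_iff_compactSpace.1 (isCompact_closedBall 0 R)
  -- For a fixed open `U`, the pairs `(g, z)` with a secant outside `U` form a closed set.
  have hU : ∀ U : Set ((E →L[ℝ] E) × E), IsOpen U → IsClosed {q : C(X, E) × Z |
      (∀ x, η ≤ ‖q.1 x - q.2‖) ∧ ¬ secantData δ q.1 (q.2 : E) ⊆ U} := by
    intro U hU
    let S : Set ((C(X, E) × Z) × X × X) := {r | (∀ x, η ≤ ‖r.1.1 x - r.1.2‖) ∧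
      δ ≤ dist r.2.1 r.2.2 ∧ ‖r.1.1 r.2.1 - r.1.2‖ ^ 2 • (r.1.1 r.2.2 - (r.1.2 : E)) =
        inner ℝ (r.1.1 r.2.1 - (r.1.2 : E)) (r.1.1 r.2.2 - (r.1.2 : E)) •
          (r.1.1 r.2.1 - (r.1.2 : E))}
    have hS : IsClosed S := by
      refine IsClosed.and ?_ (IsClosed.and (isClosed_le (by fun_prop) (by fun_prop))
        (isClosed_eq (by fun_prop) (by fun_prop)))
      simp only [Set.ofPred_forall]
      exact isClosed_iInter fun x => isClosed_le (by fun_prop) (by fun_prop)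
    have hcont : ContinuousOn (fun r : (C(X, E) × Z) × X × X =>
        lineData (r.1.2 : E) (r.1.1 r.2.1)) S := by
      refine continuousOn_lineData.comp
        (f := fun r : (C(X, E) × Z) × X × X => ((r.1.2 : E), r.1.1 r.2.1))
        (Continuous.continuousOn (by fun_prop)) fun r hr h => ?_
      have h1 := hr.1 r.2.1
      rw [show r.1.1 r.2.1 = r.1.2 from h, sub_self, norm_zero] at h1
      exact hη.not_ge h1
    convert isClosedMap_fst_of_compactSpace _
      (hcont.preimage_isClosed_of_isClosed hS hU.isClosed_compl) using 1
    ext q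
    constructor
    · rintro ⟨h1, h2⟩
      obtain ⟨_, ⟨x, y, hd, hc, rfl⟩, hn⟩ := Set.not_subset.1 h2
      exact ⟨(q, x, y), ⟨⟨h1, hd, hc⟩, hn⟩, rfl⟩
    · rintro ⟨⟨q, x, y⟩, ⟨⟨h1, hd, hc⟩, hn⟩, rfl⟩
      exact ⟨h1, fun hsub => hn (hsub ⟨x, y, hd, hc, rfl⟩)⟩
  have hbad : IsClosed {q : C(X, E) × Z | (∀ x, η ≤ ‖q.1 x - q.2‖) ∧
      ¬ FinelySeparated ε (secantData δ q.1 (q.2 : E))} := by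
    have hdist : IsClosed {q : C(X, E) × Z | ∀ x, η ≤ ‖q.1 x - q.2‖} := by
      simp only [Set.ofPred_forall]
      exact isClosed_iInter fun x => isClosed_le (by fun_prop) (by fun_prop)
    convert hdist.inter (isClosed_biInter (s := {𝒱 : Set (Set ((E →L[ℝ] E) × E)) |
      (∀ V ∈ 𝒱, IsOpen V) ∧ (∀ V ∈ 𝒱, Metric.ediam V ≤ ε) ∧ 𝒱.PairwiseDisjoint id})
      fun 𝒱 h𝒱 => hU (⋃₀ 𝒱) (isOpen_sUnion h𝒱.1)) using 1
    ext q
    constructor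
    · rintro ⟨h1, h2⟩
      exact ⟨h1, Set.mem_iInter₂.2 fun 𝒱 h𝒱 =>
        ⟨h1, fun hsub => h2 ⟨𝒱, h𝒱.1, h𝒱.2.1, h𝒱.2.2, hsub⟩⟩⟩
    · rintro ⟨h1, h2⟩
      refine ⟨h1, ?_⟩
      rintro ⟨𝒱, ho, hε, hd, hsub⟩
      exact (Set.mem_iInter₂.1 h2 𝒱 ⟨ho, hε, hd⟩).2 hsub
  rw [← isClosed_compl_iff]
  convert isClosedMap_fst_of_compactSpace _ hbad using 1
  ext g
  constructor
  · intro hg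
    simp only [separatedMaps, Set.mem_compl_iff, Set.mem_ofPred_eq, not_forall] at hg
    obtain ⟨z, hz, h1, h2⟩ := hg
    exact ⟨(g, ⟨z, mem_closedBall_zero_iff.2 hz⟩), ⟨h1, h2⟩, rfl⟩
  · rintro ⟨⟨g, z⟩, ⟨h1, h2⟩, rfl⟩ hg
    exact h2 (hg z (mem_closedBall_zero_iff.1 z.2) h1)

/-- Density: `g₀` is approximated by a map that is piecewise linear with respect to a fine cover of
order `n` and vertices in general position. -/
theorem dense_separatedMaps {X E : Type*} [MetricSpace X] [CompactSpace X]
    [NormedAddCommGroup E] [InnerProductSpace ℝ E] [FiniteDimensional ℝ E] {n : ℕ}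
    (hX : CoveringDimLE X n) (hn : 2 * n + 1 ≤ Module.finrank ℝ E) (R : ℝ) {η δ r : ℝ}
    (hη : 0 < η) (hδ : 0 < δ) (hr : 0 < r) :
    Dense (separatedMaps X E R η δ (2 * ENNReal.ofReal r)) := by
  refine Metric.dense_iff.2 fun g₀ θ hθ => ?_
  have huc := CompactSpace.uniformContinuous_of_continuous g₀.continuous
  obtain ⟨ρ₀, hρ₀, hg₀⟩ := Metric.uniformContinuous_iff.1 huc (θ / 2) (half_pos hθ)
  let ρ := min ρ₀ δ / 2
  have hρ : 0 < ρ := half_pos (lt_min hρ₀ hδ)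
  have hρ2 : 2 * ρ = min ρ₀ δ := by simp only [ρ]; ring
  obtain ⟨t, -, htfin, ht⟩ := isCompact_univ.finite_cover_balls (X := X) hρ
  obtain ⟨𝒱, hVfin, hVo, hVc, hVr, hVn⟩ := hX ((fun c => Metric.ball c ρ) '' t)
    (htfin.image _) (by rintro _ ⟨c, -, rfl⟩; exact Metric.isOpen_ball)
    (by rw [Set.sUnion_image]; exact Set.univ_subset_iff.1 ht)
  have hVdist : ∀ V ∈ 𝒱, ∀ x ∈ V, ∀ y ∈ V, dist x y < min ρ₀ δ := by
    intro V hV x hx y hy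
    obtain ⟨_, ⟨c, -, rfl⟩, hc⟩ := hVr V hV
    have h1 := Metric.mem_ball.1 (hc hx)
    have h2 := Metric.mem_ball'.1 (hc hy)
    have h3 := dist_triangle x c y
    linarith
  let := hVfin.fintype
  obtain ⟨ψ, hψ⟩ := PartitionOfUnity.exists_isSubordinate isClosed_univ
    (fun V : 𝒱 => (V : Set X)) (fun V => hVo V V.2) (by
      rw [← Set.sUnion_eq_iUnion, hVc])
  have hψV : ∀ (V : 𝒱) x, ψ V x ≠ 0 → x ∈ (V : Set X) := fun V x hx =>
    hψ V (subset_tsupport _ hx)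
  have hψsum : ∀ x, ∑ V, ψ V x = 1 := fun x => by
    rw [← finsum_eq_sum_of_fintype]
    exact ψ.sum_eq_one (Set.mem_univ x)
  -- The vertex of `V` is close to the value of `g₀` at a point of `V`.
  have hcen : ∀ V : 𝒱, ∃ e : E, ∀ x ∈ (V : Set X), dist (g₀ x) e < θ / 2 := by
    intro V
    rcases (V : Set X).eq_empty_or_nonempty with h | ⟨y, hy⟩
    · exact ⟨0, by simp [h]⟩
    · exact ⟨g₀ y, fun x hx => hg₀ ((hVdist V V.2 x hx y hy).trans_le (min_le_left _ _))⟩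
  choose e he using hcen
  obtain ⟨p, hpe, hp⟩ := exists_near_generalPosition e (half_pos hθ)
  let g : C(X, E) := ⟨fun x => ∑ V, ψ V x • p V, by fun_prop⟩
  refine ⟨g, ?_, fun z _ hz => ?_⟩
  · rw [Metric.mem_ball, ContinuousMap.dist_lt_iff hθ]
    intro x
    have hx : g x - g₀ x = ∑ V, ψ V x • (p V - g₀ x) := by
      simp only [g, ContinuousMap.coe_mk, smul_sub, Finset.sum_sub_distrib, ← Finset.sum_smul,
        hψsum, one_smul]
    have hmem : g x ∈ Metric.ball (g₀ x) θ := by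
      have hconv := (convex_ball (g₀ x) θ).finsum_mem (w := fun V => ψ V x) (z := p)
        (fun V => ψ.nonneg V x) (ψ.sum_eq_one (Set.mem_univ x)) (fun V hV => ?_)
      · rwa [finsum_eq_sum_of_fintype] at hconv
      · rw [Metric.mem_ball]
        have h1 := dist_triangle (p V) (e V) (g₀ x)
        have h2 := hpe V
        have h3 := he V x (hψV V x hV)
        rw [dist_comm] at h3
        linarith
    exact hmem
  · refine (finite_secantData (n := n) (φ := fun x V => ψ V x)
      (fun w hw => hp w (hw.trans (by omega))) hψsum (fun x => ?_) (fun x y hxy => ?_)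
      fun x hx => ?_).finelySeparated hr
    · have h1 : (Subtype.val '' Function.support fun V : 𝒱 => ψ V x) ⊆ {V ∈ 𝒱 | x ∈ V} := by
        rintro _ ⟨V, hV, rfl⟩
        exact ⟨V.2, hψV V x hV⟩
      rw [← Set.ncard_image_of_injective _ Subtype.val_injective]
      have h2 := (Set.encard_le_encard h1).trans (hVn x)
      rw [← Set.Finite.cast_ncard_eq (Set.toFinite _)] at h2
      exact_mod_cast h2
    · refine Set.disjoint_left.2 fun V hVx hVy => hxy.not_gt ?_
      exact (hVdist V V.2 x (hψV V x hVx) y (hψV V y hVy)).trans_le (min_le_right _ _)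
    · have h1 := hz x
      rw [show g x = z from hx, sub_self, norm_zero] at h1
      exact hη.not_ge h1

/-! ### Dimension of the set of secants -/

/-- Coordinates of secants do come from lines in `planesThrough`. -/
theorem secantData_subset_range_coords {X : Type*} [MetricSpace X] {m : ℕ} {δ : ℝ} (hδ : 0 < δ)
    (g : C(X, EuclideanSpace ℝ (Fin m))) {z : EuclideanSpace ℝ (Fin m)} (hz : z ∉ Set.range g) :
    secantData δ g z ⊆ Set.range fun P : planesThrough 2 1 m g z => P.1.coords := by
  rintro _ ⟨x, y, hd, hc, rfl⟩
  have hx : g x ≠ z := fun h => hz ⟨x, h⟩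
  have hxy : x ≠ y := by
    rintro rfl
    rw [dist_self] at hd
    exact hδ.not_ge hd
  have hzP : z ∈ (AffinePlane.lineThrough hx).toAffineSubspace := left_mem_affineSpan_pair ℝ _ _
  have hxP : g x ∈ (AffinePlane.lineThrough hx).toAffineSubspace :=
    right_mem_affineSpan_pair ℝ _ _
  have hyP : g y ∈ (AffinePlane.lineThrough hx).toAffineSubspace := by
    have hu : ‖g x - z‖ ^ 2 ≠ 0 := by
      have := sub_ne_zero.2 hx
      positivity
    have : g y = AffineMap.lineMap z (g x)
        (inner ℝ (g x - z) (g y - z) / ‖g x - z‖ ^ 2) := by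
      rw [AffineMap.lineMap_apply, vsub_eq_sub, vadd_eq_add, div_eq_inv_mul, mul_smul, ← hc,
        smul_smul, inv_mul_cancel₀ hu, one_smul, sub_add_cancel]
    rw [this]
    exact AffineMap.lineMap_mem_affineSpan_pair _ _ _
  refine ⟨⟨AffinePlane.lineThrough hx, ?_, hzP⟩, AffinePlane.coords_eq_lineData _ hzP hxP hx⟩
  refine (Set.encard_pair hxy).symm.trans_le (Set.encard_le_encard ?_)
  rintro _ (rfl | rfl)
  exacts [hxP, hyP]

theorem exists_coords_mem_secantData {X : Type*} [MetricSpace X] {m : ℕ}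
    (g : C(X, EuclideanSpace ℝ (Fin m))) {z : EuclideanSpace ℝ (Fin m)} (hz : z ∉ Set.range g)
    (P : planesThrough 2 1 m g z) : ∃ k : ℕ, P.1.coords ∈ secantData (1 / ((k : ℝ) + 1)) g z := by
  obtain ⟨P, hP, hzP⟩ := P
  obtain ⟨x, y, hx, hy, hxy⟩ := Set.one_lt_encard_iff.1
    (lt_of_lt_of_le (by norm_num) hP : (1 : ℕ∞) < _)
  have hgx : g x ≠ z := fun h => hz ⟨x, h⟩
  obtain ⟨k, hk⟩ := exists_nat_one_div_lt (dist_pos.2 hxy)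
  refine ⟨k, x, y, hk.le, ?_, (P.coords_eq_lineData hzP hx hgx).symm⟩
  have hmem : g y - z ∈ ℝ ∙ (g x - z) := by
    rw [← P.direction_eq_span hzP hx hgx]
    exact AffineSubspace.vsub_mem_direction hy hzP
  obtain ⟨c, hc⟩ := Submodule.mem_span_singleton.1 hmem
  rw [← hc, inner_smul_right, real_inner_self_eq_norm_sq, smul_smul, mul_comm]

theorem coveringDimLE_planesThrough_iff {X : Type*} [MetricSpace X] [CompactSpace X] {m : ℕ}
    (g : C(X, EuclideanSpace ℝ (Fin m))) {z : EuclideanSpace ℝ (Fin m)} (hz : z ∉ Set.range g) :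
    CoveringDimLE (planesThrough 2 1 m g z) 0 ↔ ∀ k j : ℕ,
      FinelySeparated (2 * ENNReal.ofReal (1 / (j + 1))) (secantData (1 / ((k : ℝ) + 1)) g z) := by
  have hind : Topology.IsInducing fun P : planesThrough 2 1 m g z => P.1.coords :=
    (AffinePlane.isInducing_coords m 1).comp Topology.IsInducing.subtypeVal
  have hcomp : ∀ k : ℕ, IsCompact (secantData (1 / ((k : ℝ) + 1)) g z) := fun k =>
    isCompact_secantData _ g.continuous hz
  have hsub : ∀ k : ℕ, secantData (1 / ((k : ℝ) + 1)) g z ⊆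
      Set.range fun P : planesThrough 2 1 m g z => P.1.coords := fun k =>
    secantData_subset_range_coords (by positivity) g hz
  refine ⟨fun h k j => h.finelySeparated hind (hcomp k) (hsub k) (by positivity), fun h => ?_⟩
  have := hind.pseudoMetrizableSpace
  refine coveringDimLE_zero_of_iUnion_isClosed
    (C := fun k : ℕ => (fun P : planesThrough 2 1 m g z => P.1.coords) ⁻¹'
      secantData (1 / ((k : ℝ) + 1)) g z)
    (fun k => (hcomp k).isClosed.preimage hind.continuous)
    (Set.eq_univ_of_forall fun P => Set.mem_iUnion.2 (exists_coords_mem_secantData g hz P))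
    fun k => ?_
  refine coveringDimLE_zero_of_finelySeparated (hind.comp Topology.IsInducing.subtypeVal) ?_ ?_
  all_goals rw [Set.range_comp, Subtype.range_coe, Set.image_preimage_eq_of_subset (hsub k)]
  exacts [hcomp k, h k]

theorem setOf_coveringDimLE_planesThrough_eq_iInter (X : Type*) [MetricSpace X] [CompactSpace X]
    (m : ℕ) :
    {g : C(X, EuclideanSpace ℝ (Fin m)) |
      ∀ z, z ∉ Set.range g → CoveringDimLE (planesThrough 2 1 m g z) 0} =
    ⋂ i : ℕ × ℕ × ℕ, separatedMaps X (EuclideanSpace ℝ (Fin m)) i.1 (1 / ((i.1 : ℝ) + 1))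
      (1 / ((i.2.1 : ℝ) + 1)) (2 * ENNReal.ofReal (1 / ((i.2.2 : ℝ) + 1))) := by
  ext g
  rw [Set.mem_iInter]
  refine ⟨fun hg i z _ hz => ?_, fun hg z hz => ?_⟩
  · have hz' : z ∉ Set.range g := by
      rintro ⟨x, rfl⟩
      have h1 := hz x
      rw [sub_self, norm_zero] at h1
      exact (by positivity : (0 : ℝ) < 1 / ((i.1 : ℝ) + 1)).not_ge h1
    exact (coveringDimLE_planesThrough_iff g hz').1 (hg z hz') _ _
  · rw [coveringDimLE_planesThrough_iff g hz]
    intro k j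
    obtain ⟨η, hη, hball⟩ := Metric.isOpen_iff.1
      (isCompact_range g.continuous).isClosed.isOpen_compl z hz
    obtain ⟨N₁, hN₁⟩ := exists_nat_one_div_lt hη
    obtain ⟨N₂, hN₂⟩ := exists_nat_ge ‖z‖
    refine hg (max N₁ N₂, k, j) z (hN₂.trans (by simp)) fun x => ?_
    have h1 : η ≤ ‖g x - z‖ := by
      by_contra! h
      exact hball (by rwa [Metric.mem_ball, dist_eq_norm] : g x ∈ Metric.ball z η) ⟨x, rfl⟩
    refine le_trans ?_ (hN₁.le.trans h1)
    exact one_div_le_one_div_of_le (by positivity) (by simp)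

theorem theorem1p1 {X : Type*} [MetricSpace X] [CompactSpace X] (n m : ℕ)
    (hX : CoveringDimLE X n) (hm : 2 * n + 1 ≤ m) :
    Dense {g : C(X, EuclideanSpace ℝ (Fin m)) |
        ∀ z, z ∉ Set.range g → CoveringDimLE (planesThrough 2 1 m g z) 0} ∧
      IsGδ {g : C(X, EuclideanSpace ℝ (Fin m)) |
        ∀ z, z ∉ Set.range g → CoveringDimLE (planesThrough 2 1 m g z) 0} := by
  rw [setOf_coveringDimLE_planesThrough_eq_iInter]
  have hopen := fun i : ℕ × ℕ × ℕ => isOpen_separatedMaps (X := X)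
    (E := EuclideanSpace ℝ (Fin m)) i.1 (by positivity : (0 : ℝ) < 1 / ((i.1 : ℝ) + 1))
    (1 / ((i.2.1 : ℝ) + 1)) (2 * ENNReal.ofReal (1 / ((i.2.2 : ℝ) + 1)))
  exact ⟨dense_iInter_of_isOpen hopen fun i => dense_separatedMaps hX (by simpa using hm) _
    (by positivity) (by positivity) (by positivity), IsGδ.iInter_of_isOpen hopen⟩
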